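/- Let $V$ and $H$ be real Hilbert spaces with $V\subset H=H'\subset V'$, where $V$ is densely and continuously embedded in $H$ and $V'$ is the dual of $V$; $|\cdot|$ is the norm of $H$. Let $\mathcal L:V\to V'$ be linear, self-adjoint and positive definite, $\|u\|:=(\mathcal Lu,u)^{1/2}$ for $u\in V$, and $\|v\|_\star:=\sup_{u\in V\setminus\{0\}}|(v,u)|/\|u\|$ for $v\in V'$. For $k\in\{2,3,4\}$ and $\beta\ge 1$ let $a_{k,q}(\beta)$ $(0\le q\le k)$ and $b_{k,q}(\beta),c_{k,q}(\beta)$ $(0\le q\le k-1)$ be the unique solutions of (with $0^0=1$) $$\sum_{q=0}^k(\beta-1+k-q)^m a_{k,q}=-\delta_{m,1}\ (0\le m\le k),$$ $$\sum_{q=0}^{k-1}(\beta+k-2-q)^m b_{k,q}=\delta_{m,0},\qquad \sum_{q=0}^{k-1}(\beta+k-1-q)^m c_{k,q}=\delta_{m,0}\quad(0\le m\le k-1),$$ and put $A_k^\beta(\phi^i)=\sum_{q=0}^k a_{k,q}\phi^{i-k+q}$, $B_k^\beta(\phi^i)=\sum_{q=0}^{k-1}b_{k,q}\phi^{i-k+1+q}$,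 $C_k^\beta(\phi^i)=\sum_{q=0}^{k-1}c_{k,q}\phi^{i-k+1+q}$, and $\eta_2(\beta)=\frac{\beta-1}{\beta}$, $\eta_3(\beta)=\frac{\beta-1}{\beta+1}$, $\eta_4(\beta)=\frac{\beta-1}{\beta+3}$. Theorem. Let $k\in\{2,3\}$ and $\beta>1$, or $k=4$ and $\beta\ge2$. There are constants $g_k>0$ and $C$, depending only on $k$ and $\beta$ (in particular independent of $\Delta t$, $T$, $f$, $\mathcal L$, $V$, $H$), such that the following holds. Let $\Delta t>0$, $T$ real, $C_f\ge0$, $f$ a $V'$-valued function of time, and let $n$ satisfy $k\le n+1\le T/\Delta t$. If $(\phi^j)_{j\ge0}\subset V$ satisfies $$\frac{A_k^\beta(\phi^{m+1})}{\Delta t}+\mathcal L B_k^\beta(\phi^{m+1})=f\big((m+\beta)\Delta t\big)\quad\text{in }V'$$ and $\|f((m+\beta)\Delta t)\|_\star^2\le C_f$ for all $m$ with $k\le m+1\le n+1$, then $$g_k|\phi^{n+1}|^2+\tfrac12\Delta t\,\eta_k(\beta)\sum_{q=k}^{n+1}\|C_k^\beta(\phi^q)\|^2\le C\sum_{q=0}^{k-1}\big(|\phi^q|^2+\Delta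 t\|\phi^q\|^2\big)+\frac{T\,C_f}{2\eta_k(\beta)}.$$ -/

import Mathlib

open scoped ENNReal NNReal

noncomputable section

namespace BDFStability

/-- The coefficients `a_{k,q}(β)`, `0 ≤ q ≤ k`, of the difference formula for the time derivative
at `t^{n+β}`, for `k = 2, 3, 4` (and `0` otherwise). -/
def aCoeff : ℕ → ℝ → ℕ → ℝ
  | 2, β, 0 => (2 * β - 1) / 2
  | 2, β, 1 => -2 * β
  | 2, β, 2 => (2 * β + 1) / 2
  | 3, β, 0 => -(3 * β ^ 2 - 1) / 6
  | 3, β, 1 => (9 * β ^ 2 + 6 * β - 6) / 6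
  | 3, β, 2 => -(9 * β ^ 2 + 12 * β - 3) / 6
  | 3, β, 3 => (3 * β ^ 2 + 6 * β + 2) / 6
  | 4, β, 0 => (2 * β ^ 3 + 3 * β ^ 2 - β - 1) / 12
  | 4, β, 1 => (-8 * β ^ 3 - 18 * β ^ 2 + 4 * β + 6) / 12
  | 4, β, 2 => (12 * β ^ 3 + 36 * β ^ 2 + 6 * β - 18) / 12
  | 4, β, 3 => (-8 * β ^ 3 - 30 * β ^ 2 - 20 * β + 10) / 12
  | 4, β, 4 => (2 * β ^ 3 + 9 * β ^ 2 + 11 * β + 3) / 12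
  | _, _, _ => 0

/-- The coefficients `b_{k,q}(β)`, `0 ≤ q ≤ k - 1`, of the implicit approximation at `t^{n+β}`,
for `k = 2, 3, 4` (and `0` otherwise). -/
def bCoeff : ℕ → ℝ → ℕ → ℝ
  | 2, β, 0 => -(β - 1)
  | 2, β, 1 => β
  | 3, β, 0 => (β ^ 2 - β) / 2
  | 3, β, 1 => -(β ^ 2 - 1)
  | 3, β, 2 => (β ^ 2 + β) / 2
  | 4, β, 0 => (-β ^ 3 + β) / 6
  | 4, β, 1 => (β ^ 3 + β ^ 2 - 2 * β) / 2
  | 4, β, 2 => (-β ^ 3 - 2 * β ^ 2 + β + 2) / 2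
  | 4, β, 3 => (β ^ 3 + 3 * β ^ 2 + 2 * β) / 6
  | _, _, _ => 0

/-- The coefficients `c_{k,q}(β)`, `0 ≤ q ≤ k - 1`, of the explicit approximation at `t^{n+β}`,
for `k = 2, 3, 4` (and `0` otherwise). -/
def cCoeff : ℕ → ℝ → ℕ → ℝ
  | 2, β, 0 => -β
  | 2, β, 1 => β + 1
  | 3, β, 0 => (β ^ 2 + β) / 2
  | 3, β, 1 => -(β ^ 2 + 2 * β)
  | 3, β, 2 => (β ^ 2 + 3 * β + 2) / 2
  | 4, β, 0 => (-β ^ 3 - 3 * β ^ 2 - 2 * β) / 6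
  | 4, β, 1 => (β ^ 3 + 4 * β ^ 2 + 3 * β) / 2
  | 4, β, 2 => (-β ^ 3 - 5 * β ^ 2 - 6 * β) / 2
  | 4, β, 3 => (β ^ 3 + 6 * β ^ 2 + 11 * β + 6) / 6
  | _, _, _ => 0

/-- The constants `η_k(β)`, for `k = 2, 3, 4` (and `0` otherwise). -/
def eta : ℕ → ℝ → ℝ
  | 2, β => (β - 1) / β
  | 3, β => (β - 1) / (β + 1)
  | 4, β => (β - 1) / (β + 3)
  | _, _ => 0

section Combinations

variable {E : Type*} [AddCommGroup E] [Module ℝ E]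

/-- `A_k^β(φ^i) = ∑_{q=0}^{k} a_{k,q}(β) φ^{i-k+q}`, for `i ≥ k`. -/
def opA (k : ℕ) (β : ℝ) (φ : ℕ → E) (i : ℕ) : E :=
  ∑ q ∈ Finset.range (k + 1), aCoeff k β q • φ (i + q - k)

/-- `B_k^β(φ^i) = ∑_{q=0}^{k-1} b_{k,q}(β) φ^{i-k+1+q}`, for `i + 1 ≥ k`. -/
def opB (k : ℕ) (β : ℝ) (φ : ℕ → E) (i : ℕ) : E :=
  ∑ q ∈ Finset.range k, bCoeff k β q • φ (i + 1 + q - k)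

/-- `C_k^β(φ^i) = ∑_{q=0}^{k-1} c_{k,q}(β) φ^{i-k+1+q}`, for `i + 1 ≥ k`. -/
def opC (k : ℕ) (β : ℝ) (φ : ℕ → E) (i : ℕ) : E :=
  ∑ q ∈ Finset.range k, cCoeff k β q • φ (i + 1 + q - k)

end Combinations

section Setting

variable {V H : Type*} [NormedAddCommGroup V] [InnerProductSpace ℝ V]
  [NormedAddCommGroup H] [InnerProductSpace ℝ H]

/-- The inclusion `H = H' ⊂ V'` induced by the embedding `ι : V → H`: an element `h` of `H` acts
on `V` by `v ↦ (h, ι v)`. -/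
def toDualV (ι : V →L[ℝ] H) (h : H) : StrongDual ℝ V :=
  (innerSL ℝ h).comp ι

/-- The energy norm `‖u‖ = (L u, u)^{1/2}`. -/
def energyNorm (L : V →ₗ[ℝ] StrongDual ℝ V) (u : V) : ℝ :=
  Real.sqrt (L u u)

/-- The dual norm `‖v‖_⋆ = sup_{u ≠ 0} |(v, u)| / ‖u‖`, with values in `[0, ∞]`. -/
def starNorm (L : V →ₗ[ℝ] StrongDual ℝ V) (v : StrongDual ℝ V) : ℝ≥0∞ :=
  ⨆ (u : V) (_ : u ≠ 0), ENNReal.ofReal (|v u| / energyNorm L u)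

/-- The scheme at step `n`, an identity in `V'`:
`A_k^β(φ^{n+1}) / Δt + L B_k^β(φ^{n+1}) = f(t^{n+β})` with `t^{n+β} = (n + β) Δt`. -/
def SchemeStep (k : ℕ) (β Δt : ℝ) (ι : V →L[ℝ] H) (L : V →ₗ[ℝ] StrongDual ℝ V)
    (f : ℝ → StrongDual ℝ V) (φ : ℕ → V) (n : ℕ) : Prop :=
  (1 / Δt) • toDualV ι (ι (opA k β φ (n + 1))) + L (opB k β φ (n + 1)) = f ((n + β) * Δt)

end Setting

end BDFStability

end

/-! Testing the scheme with `opC` and summing reduces stability to two lower bounds: one for the sum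
of (A, C) in H, one for the sum of (B - ηC, C) in the energy product of `L`. The source costs only
half of the dissipation η‖C‖², by Young's inequality. Both bounds are first proved for real
sequences, by G-stability: each scalar product is the increment of a quadratic form in a sliding
window, plus something nonnegative, so its sum telescopes (`exists_quadForm_le_of_step`). The forms
are explicit in backward differences, with entries rational in β. To pass to vectors, the Gram
matrix of finitely many φ's is factored as BᵀB (`exists_sum_mul_eq`). Its rows are real sequences to
which the scalar bounds apply, so the constants depend on neither the space nor `L`. -/

namespace BDFStability

/-! ### Quadratic forms: positivity, Gram factorisation, telescoping. -/

/-- The quadratic form `∑ i j, M i j * y i * y j`. -/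
def quadForm {k : ℕ} (M : Matrix (Fin k) (Fin k) ℝ) (y : Fin k → ℝ) : ℝ :=
  ∑ i, ∑ j, M i j * (y i * y j)

lemma quadForm_le {k : ℕ} (M : Matrix (Fin k) (Fin k) ℝ) {y : Fin k → ℝ} {R : ℝ}
    (hy : ∀ i, y i ^ 2 ≤ R) : quadForm M y ≤ (∑ i, ∑ j, |M i j|) * R := by
  simp only [quadForm, Finset.sum_mul]
  refine Finset.sum_le_sum fun i _ ↦ Finset.sum_le_sum fun j _ ↦ ?_
  refine (le_abs_self _).trans ?_
  rw [abs_mul]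
  refine mul_le_mul_of_nonneg_left ?_ (abs_nonneg _)
  rw [abs_le]
  constructor <;> nlinarith [hy i, hy j, sq_nonneg (y i - y j), sq_nonneg (y i + y j)]

/-- Completing the square in `y` leaves the Schur complement det / c as the coefficient of x², which
serves as `g`. -/
lemma exists_pos_mul_sq_le_binary {a b c : ℝ} (hc : 0 < c) (h : 0 < a * c - b ^ 2) :
    ∃ g > 0, ∀ x y : ℝ, g * x ^ 2 ≤ a * x ^ 2 + 2 * b * (x * y) + c * y ^ 2 := by
  refine ⟨(a * c - b ^ 2) / c, by positivity, fun x y ↦ ?_⟩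
  have key : a * x ^ 2 + 2 * b * (x * y) + c * y ^ 2
      = (a * c - b ^ 2) / c * x ^ 2 + (b * x + c * y) ^ 2 / c := by
    field_simp
    ring
  rw [key]
  have : 0 ≤ (b * x + c * y) ^ 2 / c := by positivity
  linarith

/-- Multiplying by `f` and completing the square in `z` leaves a binary form whose determinant is
`f` times the full one; hence the trailing minors. -/
lemma exists_pos_mul_sq_le_ternary {a b c d e f : ℝ} (hf : 0 < f) (h₂ : 0 < d * f - e ^ 2)
    (h₃ : 0 < a * (d * f - e ^ 2) - b * (b * f - e * c) + c * (b * e - d * c)) :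
    ∃ g > 0, ∀ x y z : ℝ, g * x ^ 2 ≤
      a * x ^ 2 + 2 * b * (x * y) + 2 * c * (x * z) + d * y ^ 2 + 2 * e * (y * z) + f * z ^ 2 := by
  obtain ⟨g, hg, H⟩ := exists_pos_mul_sq_le_binary (a := a * f - c ^ 2) (b := b * f - c * e) h₂
    (by linear_combination mul_pos hf h₃)
  refine ⟨g / f, by positivity, fun x y z ↦ ?_⟩
  rw [div_mul_eq_mul_div, div_le_iff₀ hf]
  linear_combination H x y + sq_nonneg (c * x + e * y + f * z)

/-- The same elimination, now of `w`; `h₄` is the determinant of the reduced ternary form. -/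
lemma exists_pos_mul_sq_le_quaternary {a b c d e f p q r s : ℝ} (hs : 0 < s)
    (h₂ : 0 < q * s - r ^ 2)
    (h₃ : 0 < e * (q * s - r ^ 2) - f * (f * s - r * p) + p * (f * r - q * p))
    (h₄ : 0 < (a * s - d ^ 2) * ((e * s - p ^ 2) * (q * s - r ^ 2) - (f * s - p * r) ^ 2)
      - (b * s - d * p) * ((b * s - d * p) * (q * s - r ^ 2) - (f * s - p * r) * (c * s - d * r))
      + (c * s - d * r) * ((b * s - d * p) * (f * s - p * r) - (e * s - p ^ 2) * (c * s - d * r))) :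
    ∃ g > 0, ∀ x y z w : ℝ, g * x ^ 2 ≤
      a * x ^ 2 + 2 * b * (x * y) + 2 * c * (x * z) + 2 * d * (x * w)
        + e * y ^ 2 + 2 * f * (y * z) + 2 * p * (y * w)
        + q * z ^ 2 + 2 * r * (z * w) + s * w ^ 2 := by
  obtain ⟨g, hg, H⟩ := exists_pos_mul_sq_le_ternary (a := a * s - d ^ 2) (b := b * s - d * p)
    (c := c * s - d * r) (d := e * s - p ^ 2) (e := f * s - p * r) h₂
    (by linear_combination mul_pos hs h₃) h₄
  refine ⟨g / s, by positivity, fun x y z w ↦ ?_⟩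
  rw [div_mul_eq_mul_div, div_le_iff₀ hs]
  linear_combination H x y z + sq_nonneg (d * x + p * y + r * z + s * w)

open Matrix MatrixOrder in
/-- A positive semidefinite symmetric form is, on finitely many vectors, a sum of products of
real coordinates. -/
lemma exists_sum_mul_eq {E : Type*} [AddCommGroup E] [Module ℝ E] (b : E →ₗ[ℝ] E →ₗ[ℝ] ℝ)
    (hsymm : ∀ u v, b u v = b v u) (hpos : ∀ u, 0 ≤ b u u) (φ : ℕ → E) (N : ℕ) :
    ∃ P : Fin N → ℕ → ℝ, ∀ i < N, ∀ j < N, b (φ i) (φ j) = ∑ l, P l i * P l j := by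
  let M : Matrix (Fin N) (Fin N) ℝ := Matrix.of fun i j ↦ b (φ i) (φ j)
  have hM : M.PosSemidef := by
    refine Matrix.PosSemidef.of_dotProduct_mulVec_nonneg ?_ fun x ↦ ?_
    · ext i j
      simp [M, hsymm (φ j)]
    · have hx : star x ⬝ᵥ (M *ᵥ x) = b (∑ i, x i • φ i) (∑ i, x i • φ i) := by
        simp [M, dotProduct, mulVec, Finset.mul_sum, mul_comm]
        exact Finset.sum_congr rfl fun i _ ↦ Finset.sum_congr rfl fun j _ ↦ by rw [hsymm (φ i)]
      exact hx ▸ hpos _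
  obtain ⟨B, hB⟩ := CStarAlgebra.nonneg_iff_eq_star_mul_self.1 hM.nonneg
  refine ⟨fun l i ↦ if h : i < N then B l ⟨i, h⟩ else 0, fun i hi j hj ↦ ?_⟩
  have := congrFun (congrFun hB ⟨i, hi⟩) ⟨j, hj⟩
  simpa [M, hi, hj, Matrix.mul_apply, Matrix.star_apply] using this

/-- Telescoping a dissipation inequality for a quadratic storage function of a sliding window. -/
lemma exists_quadForm_le_of_step {k r : ℕ} (M : Matrix (Fin r) (Fin r) ℝ)
    (y : (ℕ → ℝ) → ℕ → Fin r → ℝ) (t : (ℕ → ℝ) → ℕ → ℝ) (K : ℝ)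
    (hy : ∀ x j, y x (k - 1) j ^ 2 ≤ K * ∑ q ∈ Finset.range k, x q ^ 2)
    (hstep : ∀ x i, quadForm M (y x (i + k)) ≤ quadForm M (y x (i + k - 1)) + t x (i + k)) :
    ∃ C : ℝ, ∀ (x : ℕ → ℝ) (N : ℕ), k ≤ N →
      quadForm M (y x N) ≤ C * ∑ q ∈ Finset.range k, x q ^ 2 + ∑ i ∈ Finset.Icc k N, t x i := by
  refine ⟨(∑ i, ∑ j, |M i j|) * K, fun x N hN ↦ ?_⟩
  induction N, hN using Nat.le_induction with
  | base =>
    -- The first step starts from the window ending at `k - 1`, which the initial values bound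
    -- through `hy`.
    have h₀ := hstep x 0
    have h₁ := quadForm_le M (hy x)
    rw [zero_add] at h₀
    rw [Finset.Icc_self, Finset.sum_singleton]
    linarith
  | succ N hN ih =>
    obtain ⟨i, rfl⟩ := Nat.exists_eq_add_of_le hN
    have h := hstep x (i + 1)
    rw [show i + 1 + k = k + i + 1 by ring, Nat.add_sub_cancel] at h
    rw [Finset.sum_Icc_succ_top (by omega)]
    linarith

/-! ### Scalar inequalities for k = 2, 3, 4. -/

/-- Two-step `G`-stability of the pair `(A, C)` for scalar sequences. -/
lemma exists_sq_le_sum_opA_mul_opC_two (β : ℝ) (hβ : 1 < β) :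
    ∃ g C : ℝ, 0 < g ∧ ∀ (x : ℕ → ℝ) (N : ℕ), 2 ≤ N → g * x N ^ 2 ≤
      C * ∑ q ∈ Finset.range 2, x q ^ 2 + ∑ i ∈ Finset.Icc 2 N, opA 2 β x i * opC 2 β x i := by
  -- Expanded in s = β - 1, the polynomials below have no negative coefficients, so `positivity`
  -- settles their signs.
  obtain ⟨s, hs, rfl⟩ : ∃ s > 0, β = 1 + s := ⟨β - 1, by linarith, by ring⟩
  set β := 1 + s with hβs
  obtain ⟨C, hC⟩ := exists_quadForm_le_of_step (k := 2)
    !![1 / 2, (2 * β - 1) / 4;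
      (2 * β - 1) / 4, (2 * β ^ 2 + β - 1) / 4]
    (fun x i ↦ ![x i, x i - x (i - 1)]) (fun x i ↦ opA 2 β x i * opC 2 β x i) 20
    (fun x j ↦ by
      simp only [Finset.sum_range_succ, Finset.sum_range_zero]
      fin_cases j <;> norm_num
      · nlinarith [sq_nonneg (x 0), sq_nonneg (x 1)]
      · nlinarith [sq_nonneg (x 0 + x 1), sq_nonneg (x 0), sq_nonneg (x 1)])
    (fun x n ↦ by
      -- With d and D the first and second backward differences at `n + 2`, AC is the increment of
      -- the form plus d² + (2β² + β - 1)/4 · D².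
      have h₂ : 0 ≤ (2 * β ^ 2 + β - 1) / 4 := by rw [hβs]; ring_nf; positivity
      have := mul_nonneg h₂ (sq_nonneg (x (n + 2) - 2 * x (n + 1) + x n))
      have := sq_nonneg (x (n + 2) - x (n + 1))
      simp [quadForm, Fin.sum_univ_two, opA, opC, Finset.sum_range_succ, aCoeff, cCoeff]
      linarith)
  obtain ⟨g, hg, H⟩ := exists_pos_mul_sq_le_binary (a := 1 / 2) (b := (2 * β - 1) / 4)
    (c := (2 * β ^ 2 + β - 1) / 4) (by rw [hβs]; ring_nf; positivity)
    (by rw [hβs]; ring_nf; positivity)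
  refine ⟨g, C, hg, fun x N hN ↦ le_trans ?_ (hC x N hN)⟩
  refine (H (x N) (x N - x (N - 1))).trans_eq ?_
  simp [quadForm, Fin.sum_univ_two]
  ring

/-- Dissipativity of the pair `(B - η C, C)` for scalar sequences, two-step case. -/
lemma exists_sum_opB_mul_opC_nonneg_two (β : ℝ) (hβ : 1 < β) :
    ∃ C : ℝ, ∀ (x : ℕ → ℝ) (N : ℕ), 2 ≤ N → 0 ≤
      C * ∑ q ∈ Finset.range 2, x q ^ 2 +
        ∑ i ∈ Finset.Icc 2 N, (opB 2 β x i - eta 2 β * opC 2 β x i) * opC 2 β x i := by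
  obtain ⟨C, hC⟩ := exists_quadForm_le_of_step (k := 2)
    !![1 / 2]
    (fun x i ↦ ![x i])
    (fun x i ↦ (opB 2 β x i - eta 2 β * opC 2 β x i) * opC 2 β x i) 20
    (fun x j ↦ by
      simp only [Finset.sum_range_succ, Finset.sum_range_zero]
      fin_cases j
      norm_num
      nlinarith [sq_nonneg (x 0), sq_nonneg (x 1)])
    (fun x n ↦ by
      have h₀ : 0 < β := by linarith
      have := sq_nonneg (x (n + 2) - x (n + 1))
      have : 0 ≤ x (n + 2) ^ 2 / β := by positivity
      simp [quadForm, opB, opC, Finset.sum_range_succ, bCoeff, cCoeff, eta]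
      -- Here η is the ratio of the oldest coefficients of B and C, so B - ηC collapses to x (n + 2)
      -- / β.
      have key : (-((β - 1) * x (n + 1)) + β * x (n + 2)
          - (β - 1) / β * (-(β * x (n + 1)) + (β + 1) * x (n + 2)))
          * (-(β * x (n + 1)) + (β + 1) * x (n + 2))
          = x (n + 2) ^ 2 / β + x (n + 2) * (x (n + 2) - x (n + 1)) := by
        field_simp
        ring
      linarith)
  refine ⟨C, fun x N hN ↦ le_trans ?_ (hC x N hN)⟩
  simp only [quadForm, Fin.sum_univ_one]
  simp
  nlinarith [sq_nonneg (x N)]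

/-- Three-step `G`-stability of the pair `(A, C)` for scalar sequences. -/
lemma exists_sq_le_sum_opA_mul_opC_three (β : ℝ) (hβ : 1 < β) :
    ∃ g C : ℝ, 0 < g ∧ ∀ (x : ℕ → ℝ) (N : ℕ), 3 ≤ N → g * x N ^ 2 ≤
      C * ∑ q ∈ Finset.range 3, x q ^ 2 + ∑ i ∈ Finset.Icc 3 N, opA 3 β x i * opC 3 β x i := by
  obtain ⟨s, hs, rfl⟩ : ∃ s > 0, β = 1 + s := ⟨β - 1, by linarith, by ring⟩
  set β := 1 + s with hβs
  obtain ⟨C, hC⟩ := exists_quadForm_le_of_step (k := 3)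
    !![1 / 2, (2 * β - 1) / 4, (3 * β ^ 2 - 1) / 12;
      (2 * β - 1) / 4, (3 * β ^ 2 + 3 * β - 1) / 6, (3 * β ^ 3 + 3 * β ^ 2 - β - 1) / 12;
      (3 * β ^ 2 - 1) / 12, (3 * β ^ 3 + 3 * β ^ 2 - β - 1) / 12,
        (3 * β ^ 4 + 9 * β ^ 3 + 5 * β ^ 2 - 3 * β - 2) / 24]
    (fun x i ↦ ![x i, x i - x (i - 1), x i - 2 * x (i - 1) + x (i - 2)])
    (fun x i ↦ opA 3 β x i * opC 3 β x i) 20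
    (fun x j ↦ by
      simp only [Finset.sum_range_succ, Finset.sum_range_zero]
      fin_cases j <;> norm_num
      · nlinarith [sq_nonneg (x 0), sq_nonneg (x 1), sq_nonneg (x 2)]
      · nlinarith [sq_nonneg (x 2 + x 1), sq_nonneg (x 0), sq_nonneg (x 1), sq_nonneg (x 2)]
      · nlinarith [sq_nonneg (x 2 + x 1), sq_nonneg (x 0 + x 1), sq_nonneg (x 2 - x 0),
          sq_nonneg (x 0), sq_nonneg (x 1), sq_nonneg (x 2)])
    (fun x n ↦ by
      have h₂ : 0 ≤ (3 * β ^ 2 + 5 * β) / 12 := by rw [hβs]; positivity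
      have h₃ : 0 ≤ (3 * β ^ 4 + 9 * β ^ 3 + 5 * β ^ 2 - 3 * β - 2) / 24 := by
        rw [hβs]; ring_nf; positivity
      have := sq_nonneg (x (n + 3) - x (n + 2))
      have := mul_nonneg h₂ (sq_nonneg (x (n + 3) - 2 * x (n + 2) + x (n + 1)))
      have := mul_nonneg h₃ (sq_nonneg (x (n + 3) - 3 * x (n + 2) + 3 * x (n + 1) - x n))
      simp [quadForm, Fin.sum_univ_three, opA, opC, Finset.sum_range_succ, aCoeff, cCoeff]
      linarith)
  obtain ⟨g, hg, H⟩ := exists_pos_mul_sq_le_ternary (a := 1 / 2) (b := (2 * β - 1) / 4)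
    (c := (3 * β ^ 2 - 1) / 12) (d := (3 * β ^ 2 + 3 * β - 1) / 6)
    (e := (3 * β ^ 3 + 3 * β ^ 2 - β - 1) / 12)
    (f := (3 * β ^ 4 + 9 * β ^ 3 + 5 * β ^ 2 - 3 * β - 2) / 24)
    (by rw [hβs]; ring_nf; positivity) (by rw [hβs]; ring_nf; positivity)
    (by rw [hβs]; ring_nf; positivity)
  refine ⟨g, C, hg, fun x N hN ↦ le_trans ?_ (hC x N hN)⟩
  refine (H (x N) (x N - x (N - 1)) (x N - 2 * x (N - 1) + x (N - 2))).trans_eq ?_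
  simp [quadForm, Fin.sum_univ_three]
  ring

/-- Dissipativity of the pair `(B - η C, C)` for scalar sequences, three-step case. -/
lemma exists_sum_opB_mul_opC_nonneg_three (β : ℝ) (hβ : 1 < β) :
    ∃ C : ℝ, ∀ (x : ℕ → ℝ) (N : ℕ), 3 ≤ N → 0 ≤
      C * ∑ q ∈ Finset.range 3, x q ^ 2 +
        ∑ i ∈ Finset.Icc 3 N, (opB 3 β x i - eta 3 β * opC 3 β x i) * opC 3 β x i := by
  obtain ⟨s, hs, rfl⟩ : ∃ s > 0, β = 1 + s := ⟨β - 1, by linarith, by ring⟩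
  set β := 1 + s with hβs
  have h₁ : 0 < β + 1 := by positivity
  obtain ⟨C, hC⟩ := exists_quadForm_le_of_step (k := 3)
    ((1 / (β + 1)) • !![(3 * β + 3) / 2, (2 * β ^ 2 + β - 1) / 4;
      (2 * β ^ 2 + β - 1) / 4, (β ^ 3 + 2 * β ^ 2 + β) / 4])
    (fun x i ↦ ![x i, x i - x (i - 1)])
    (fun x i ↦ (opB 3 β x i - eta 3 β * opC 3 β x i) * opC 3 β x i) 20
    (fun x j ↦ by
      simp only [Finset.sum_range_succ, Finset.sum_range_zero]
      fin_cases j <;> norm_num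
      · nlinarith [sq_nonneg (x 0), sq_nonneg (x 1), sq_nonneg (x 2)]
      · nlinarith [sq_nonneg (x 2 + x 1), sq_nonneg (x 0), sq_nonneg (x 1), sq_nonneg (x 2)])
    (fun x n ↦ by
      have h₂ : 0 ≤ (8 * β ^ 3 + 15 * β ^ 2 + 6 * β - 1) / 32 := by
        rw [hβs]; ring_nf; positivity
      -- The exact dissipation, with the square completed in x (n + 2).
      have hd : 0 ≤ (2 * (x (n + 2) + (β + 1) / 8 * (x (n + 3) - 2 * x (n + 2) + x (n + 1))) ^ 2
          + (8 * β ^ 3 + 15 * β ^ 2 + 6 * β - 1) / 32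
            * (x (n + 3) - 2 * x (n + 2) + x (n + 1)) ^ 2) / (β + 1) := by positivity
      rw [← sub_nonneg]
      refine hd.trans_eq ?_
      simp [quadForm, Fin.sum_univ_two, opB, opC, Finset.sum_range_succ, bCoeff, cCoeff, eta]
      field_simp
      ring)
  obtain ⟨g, hg, H⟩ := exists_pos_mul_sq_le_binary (a := (3 * β + 3) / 2)
    (b := (2 * β ^ 2 + β - 1) / 4) (c := (β ^ 3 + 2 * β ^ 2 + β) / 4)
    (by rw [hβs]; positivity) (by rw [hβs]; ring_nf; positivity)
  refine ⟨C, fun x N hN ↦ le_trans ?_ (hC x N hN)⟩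
  have h₀ : 0 ≤ g * x N ^ 2 := by positivity
  refine (div_nonneg (h₀.trans (H (x N) (x N - x (N - 1)))) h₁.le).trans_eq ?_
  simp [quadForm, Fin.sum_univ_two]
  ring

/-- Four-step `G`-stability of the pair `(A, C)` for scalar sequences. -/
lemma exists_sq_le_sum_opA_mul_opC_four (β : ℝ) (hβ : 1 < β) :
    ∃ g C : ℝ, 0 < g ∧ ∀ (x : ℕ → ℝ) (N : ℕ), 4 ≤ N → g * x N ^ 2 ≤
      C * ∑ q ∈ Finset.range 4, x q ^ 2 + ∑ i ∈ Finset.Icc 4 N, opA 4 β x i * opC 4 β x i := by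
  obtain ⟨s, hs, rfl⟩ : ∃ s > 0, β = 1 + s := ⟨β - 1, by linarith, by ring⟩
  set β := 1 + s with hβs
  obtain ⟨C, hC⟩ := exists_quadForm_le_of_step (k := 4)
    !![1 / 2, (2 * β - 1) / 4, (3 * β ^ 2 - 1) / 12, (2 * β ^ 3 + 3 * β ^ 2 - β - 1) / 24;
      (2 * β - 1) / 4, (β ^ 2 + β) / 2, (6 * β ^ 3 + 9 * β ^ 2 + 3 * β - 1) / 24,
        (2 * β ^ 4 + 5 * β ^ 3 + 2 * β ^ 2 - 2 * β - 1) / 24;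
      (3 * β ^ 2 - 1) / 12, (6 * β ^ 3 + 9 * β ^ 2 + 3 * β - 1) / 24,
        (3 * β ^ 4 + 9 * β ^ 3 + 7 * β ^ 2 + 2 * β) / 24,
        (2 * β ^ 5 + 9 * β ^ 4 + 12 * β ^ 3 + 2 * β ^ 2 - 5 * β - 2) / 48;
      (2 * β ^ 3 + 3 * β ^ 2 - β - 1) / 24, (2 * β ^ 4 + 5 * β ^ 3 + 2 * β ^ 2 - 2 * β - 1) / 24,
        (2 * β ^ 5 + 9 * β ^ 4 + 12 * β ^ 3 + 2 * β ^ 2 - 5 * β - 2) / 48,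
        (2 * β ^ 6 + 15 * β ^ 5 + 39 * β ^ 4 + 38 * β ^ 3 + β ^ 2 - 17 * β - 6) / 144]
    (fun x i ↦ ![x i, x i - x (i - 1), x i - 2 * x (i - 1) + x (i - 2),
      x i - 3 * x (i - 1) + 3 * x (i - 2) - x (i - 3)])
    -- By Cauchy–Schwarz the third difference needs 1 + 9 + 9 + 1 = 20; the same constant covers
    -- every shorter window.
    (fun x i ↦ opA 4 β x i * opC 4 β x i) 20
    (fun x j ↦ by
      simp only [Finset.sum_range_succ, Finset.sum_range_zero]
      have h₀ := sq_nonneg (x 0)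
      have h₁ := sq_nonneg (x 1)
      have h₂ := sq_nonneg (x 2)
      have h₃ := sq_nonneg (x 3)
      fin_cases j <;> norm_num
      · linarith
      · linarith [sq_nonneg (x 3 + x 2)]
      · linarith [sq_nonneg (x 3 + 2 * x 2 + x 1), sq_nonneg (x 3 + x 2), sq_nonneg (x 1 + x 2),
          sq_nonneg (x 3 - x 1)]
      · linarith [sq_nonneg (3 * x 3 + x 2), sq_nonneg (x 3 - x 1), sq_nonneg (x 3 + x 0),
          sq_nonneg (x 2 + x 1), sq_nonneg (x 2 - x 0), sq_nonneg (x 1 + 3 * x 0),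
          sq_nonneg (3 * x 3 - x 1), sq_nonneg (x 2 - 3 * x 0)])
    (fun x n ↦ by
      have h₃ : 0 ≤ (β ^ 3 + 9 * β ^ 2 + 17 * β + 6) / 72 := by rw [hβs]; positivity
      have h₄ : 0 ≤ (2 * β ^ 6 + 15 * β ^ 5 + 39 * β ^ 4 + 38 * β ^ 3 + β ^ 2 - 17 * β - 6)
          / 144 := by
        rw [hβs]; ring_nf; positivity
      have hd : 0 ≤ 2 / 3 * (x (n + 4) - x (n + 3)) ^ 2 + 1 / 12 * (x (n + 4) - x (n + 2)) ^ 2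
          + (β ^ 3 + 9 * β ^ 2 + 17 * β + 6) / 72
            * (x (n + 4) - 3 * x (n + 3) + 3 * x (n + 2) - x (n + 1)) ^ 2
          + (2 * β ^ 6 + 15 * β ^ 5 + 39 * β ^ 4 + 38 * β ^ 3 + β ^ 2 - 17 * β - 6) / 144
            * (x (n + 4) - 4 * x (n + 3) + 6 * x (n + 2) - 4 * x (n + 1) + x n) ^ 2 := by
        positivity
      rw [← sub_nonneg]
      refine hd.trans_eq ?_
      simp [quadForm, Fin.sum_univ_four, opA, opC, Finset.sum_range_succ, aCoeff, cCoeff]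
      ring)
  obtain ⟨g, hg, H⟩ := exists_pos_mul_sq_le_quaternary (a := 1 / 2) (b := (2 * β - 1) / 4)
    (c := (3 * β ^ 2 - 1) / 12) (d := (2 * β ^ 3 + 3 * β ^ 2 - β - 1) / 24)
    (e := (β ^ 2 + β) / 2) (f := (6 * β ^ 3 + 9 * β ^ 2 + 3 * β - 1) / 24)
    (p := (2 * β ^ 4 + 5 * β ^ 3 + 2 * β ^ 2 - 2 * β - 1) / 24)
    (q := (3 * β ^ 4 + 9 * β ^ 3 + 7 * β ^ 2 + 2 * β) / 24)
    (r := (2 * β ^ 5 + 9 * β ^ 4 + 12 * β ^ 3 + 2 * β ^ 2 - 5 * β - 2) / 48)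
    (s := (2 * β ^ 6 + 15 * β ^ 5 + 39 * β ^ 4 + 38 * β ^ 3 + β ^ 2 - 17 * β - 6) / 144)
    (by rw [hβs]; ring_nf; positivity) (by rw [hβs]; ring_nf; positivity)
    (by rw [hβs]; ring_nf; positivity) (by rw [hβs]; ring_nf; positivity)
  refine ⟨g, C, hg, fun x N hN ↦ le_trans ?_ (hC x N hN)⟩
  refine (H (x N) (x N - x (N - 1)) (x N - 2 * x (N - 1) + x (N - 2))
    (x N - 3 * x (N - 1) + 3 * x (N - 2) - x (N - 3))).trans_eq ?_
  simp [quadForm, Fin.sum_univ_four]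
  ring

/-- Dissipativity of the pair `(B - η C, C)` for scalar sequences, four-step case. -/
lemma exists_sum_opB_mul_opC_nonneg_four (β : ℝ) (hβ : 2 ≤ β) :
    ∃ C : ℝ, ∀ (x : ℕ → ℝ) (N : ℕ), 4 ≤ N → 0 ≤
      C * ∑ q ∈ Finset.range 4, x q ^ 2 +
        ∑ i ∈ Finset.Icc 4 N, (opB 4 β x i - eta 4 β * opC 4 β x i) * opC 4 β x i := by
  obtain ⟨s, hs, rfl⟩ : ∃ s ≥ 0, β = 2 + s := ⟨β - 2, by linarith, by ring⟩
  set β := 2 + s with hβs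
  have h₁ : 0 < β + 3 := by positivity
  obtain ⟨C, hC⟩ := exists_quadForm_le_of_step (k := 4)
    ((1 / (β + 3)) • !![(7 * β + 5) / 2, (46 * β ^ 2 - 15 * β - 59) / 36,
        (5 * β ^ 3 + 12 * β ^ 2 + 7 * β) / 12;
      (46 * β ^ 2 - 15 * β - 59) / 36, (15 * β ^ 3 + 8 * β ^ 2 + 9 * β + 32) / 18,
        (8 * β ^ 4 + 13 * β ^ 3 - 16 * β ^ 2 - 29 * β) / 36;
      (5 * β ^ 3 + 12 * β ^ 2 + 7 * β) / 12, (8 * β ^ 4 + 13 * β ^ 3 - 16 * β ^ 2 - 29 * β) / 36,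
        (3 * β ^ 5 + 13 * β ^ 4 + 19 * β ^ 3 + 11 * β ^ 2 + 2 * β) / 24])
    (fun x i ↦ ![x i, x i - x (i - 1), x i - 2 * x (i - 1) + x (i - 2)])
    (fun x i ↦ (opB 4 β x i - eta 4 β * opC 4 β x i) * opC 4 β x i) 20
    (fun x j ↦ by
      simp only [Finset.sum_range_succ, Finset.sum_range_zero]
      have h₀ := sq_nonneg (x 0)
      have h₁ := sq_nonneg (x 1)
      have h₂ := sq_nonneg (x 2)
      have h₃ := sq_nonneg (x 3)
      fin_cases j <;> norm_num
      · linarith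
      · linarith [sq_nonneg (x 3 + x 2)]
      · linarith [sq_nonneg (x 3 + 2 * x 2 + x 1), sq_nonneg (x 3 + x 2), sq_nonneg (x 1 + x 2),
          sq_nonneg (x 3 - x 1)])
    (fun x n ↦ by
      -- This is where β must stay away from 1: the polynomial is already negative at β = 1.9, and
      -- the one in `h₃` is negative for 1 < β < √3.
      have h₂ : 0 ≤ (224 * β ^ 4 + 48 * β ^ 3 - 17 * β ^ 2 + 138 * β - 3481) / 5184 := by
        rw [hβs]; ring_nf; positivity
      have h₃ : 0 ≤ (β ^ 5 + β ^ 4 - 5 * β ^ 3 - 3 * β ^ 2 + 6 * β) / 72 := by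
        rw [hβs]; ring_nf; positivity
      have hd : 0 ≤ (4 * (x (n + 3) + (8 * β ^ 2 + 33 * β + 59) / 144
            * (x (n + 4) - 2 * x (n + 3) + x (n + 2))) ^ 2
          + (β ^ 2 + 3 * β + 4) / 9 * ((β ^ 2 + 2 * β) / 2
            * (x (n + 4) - 3 * x (n + 3) + 3 * x (n + 2) - x (n + 1))
            + 2 * (x (n + 3) - x (n + 2))) ^ 2
          + (224 * β ^ 4 + 48 * β ^ 3 - 17 * β ^ 2 + 138 * β - 3481) / 5184
            * (x (n + 4) - 2 * x (n + 3) + x (n + 2)) ^ 2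
          + (β ^ 5 + β ^ 4 - 5 * β ^ 3 - 3 * β ^ 2 + 6 * β) / 72
            * (x (n + 4) - 3 * x (n + 3) + 3 * x (n + 2) - x (n + 1)) ^ 2) / (β + 3) := by
        positivity
      rw [← sub_nonneg]
      refine hd.trans_eq ?_
      simp [quadForm, Fin.sum_univ_three, opB, opC, Finset.sum_range_succ, bCoeff, cCoeff, eta]
      field_simp
      ring)
  obtain ⟨g, hg, H⟩ := exists_pos_mul_sq_le_ternary (a := (7 * β + 5) / 2)
    (b := (46 * β ^ 2 - 15 * β - 59) / 36) (c := (5 * β ^ 3 + 12 * β ^ 2 + 7 * β) / 12)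
    (d := (15 * β ^ 3 + 8 * β ^ 2 + 9 * β + 32) / 18)
    (e := (8 * β ^ 4 + 13 * β ^ 3 - 16 * β ^ 2 - 29 * β) / 36)
    (f := (3 * β ^ 5 + 13 * β ^ 4 + 19 * β ^ 3 + 11 * β ^ 2 + 2 * β) / 24)
    (by rw [hβs]; positivity) (by rw [hβs]; ring_nf; positivity)
    (by rw [hβs]; ring_nf; positivity)
  refine ⟨C, fun x N hN ↦ le_trans ?_ (hC x N hN)⟩
  -- Only nonnegativity of the storage form is needed here.
  have h₀ : 0 ≤ g * x N ^ 2 := by positivity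
  refine (div_nonneg (h₀.trans
    (H (x N) (x N - x (N - 1)) (x N - 2 * x (N - 1) + x (N - 2)))) h₁.le).trans_eq ?_
  simp [quadForm, Fin.sum_univ_three]
  ring

lemma exists_sq_le_sum_opA_mul_opC {k : ℕ} {β : ℝ}
    (h : ((k = 2 ∨ k = 3) ∧ 1 < β) ∨ (k = 4 ∧ 2 ≤ β)) :
    ∃ g C : ℝ, 0 < g ∧ ∀ (x : ℕ → ℝ) (N : ℕ), k ≤ N → g * x N ^ 2 ≤
      C * ∑ q ∈ Finset.range k, x q ^ 2 + ∑ i ∈ Finset.Icc k N, opA k β x i * opC k β x i := by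
  obtain ⟨rfl | rfl, hβ⟩ | ⟨rfl, hβ⟩ := h
  exacts [exists_sq_le_sum_opA_mul_opC_two β hβ,
    exists_sq_le_sum_opA_mul_opC_three β hβ,
    exists_sq_le_sum_opA_mul_opC_four β (by linarith)]

lemma exists_sum_opB_mul_opC_nonneg {k : ℕ} {β : ℝ}
    (h : ((k = 2 ∨ k = 3) ∧ 1 < β) ∨ (k = 4 ∧ 2 ≤ β)) :
    ∃ C : ℝ, ∀ (x : ℕ → ℝ) (N : ℕ), k ≤ N → 0 ≤
      C * ∑ q ∈ Finset.range k, x q ^ 2 +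
        ∑ i ∈ Finset.Icc k N, (opB k β x i - eta k β * opC k β x i) * opC k β x i := by
  obtain ⟨rfl | rfl, hβ⟩ | ⟨rfl, hβ⟩ := h
  exacts [exists_sum_opB_mul_opC_nonneg_two β hβ,
    exists_sum_opB_mul_opC_nonneg_three β hβ,
    exists_sum_opB_mul_opC_nonneg_four β hβ]

lemma eta_pos {k : ℕ} {β : ℝ} (h : ((k = 2 ∨ k = 3) ∧ 1 < β) ∨ (k = 4 ∧ 2 ≤ β)) :
    0 < eta k β := by
  obtain ⟨rfl | rfl, hβ⟩ | ⟨rfl, hβ⟩ := h <;> exact div_pos (by linarith) (by linarith)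

/-! ### From real sequences to vectors. -/

section Transfer

variable {E : Type*} [AddCommGroup E] [Module ℝ E] {b : E →ₗ[ℝ] E →ₗ[ℝ] ℝ} {φ : ℕ → E}

/-- The index maps `s` and `t` absorb the shifts, so one computation serves `opA`, `opB` and `opC`.
-/
lemma bilin_sum_smul_sum_smul {N m m' : ℕ} {P : Fin N → ℕ → ℝ}
    (hP : ∀ i < N, ∀ j < N, b (φ i) (φ j) = ∑ l, P l i * P l j) (u v : ℕ → ℝ) {s t : ℕ → ℕ}
    (hs : ∀ q < m, s q < N) (ht : ∀ q < m', t q < N) :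
    b (∑ q ∈ Finset.range m, u q • φ (s q)) (∑ q ∈ Finset.range m', v q • φ (t q)) =
      ∑ l, (∑ q ∈ Finset.range m, u q • P l (s q)) * ∑ q ∈ Finset.range m', v q • P l (t q) := by
  simp_rw [Finset.sum_mul_sum]
  rw [LinearMap.map_sum₂, Finset.sum_comm]
  refine Finset.sum_congr rfl fun q hq ↦ ?_
  rw [map_sum, Finset.sum_comm]
  refine Finset.sum_congr rfl fun r hr ↦ ?_
  rw [map_smul, LinearMap.map_smul₂,
    hP _ (hs q (Finset.mem_range.1 hq)) _ (ht r (Finset.mem_range.1 hr)), smul_eq_mul, smul_eq_mul,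
    Finset.mul_sum, Finset.mul_sum]
  refine Finset.sum_congr rfl fun l _ ↦ ?_
  simp only [smul_eq_mul]
  ring

/-- The scalar bound is applied to each coordinate sequence `P l` and summed over `l`. -/
lemma le_sum_bilin_opA_opC {k : ℕ} {β g C : ℝ}
    (h : ∀ (x : ℕ → ℝ) (N : ℕ), k ≤ N → g * x N ^ 2 ≤
      C * ∑ q ∈ Finset.range k, x q ^ 2 + ∑ i ∈ Finset.Icc k N, opA k β x i * opC k β x i)
    (hsymm : ∀ u v, b u v = b v u) (hpos : ∀ u, 0 ≤ b u u) {N : ℕ} (hN : k ≤ N) :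
    g * b (φ N) (φ N) ≤ C * ∑ q ∈ Finset.range k, b (φ q) (φ q) +
      ∑ i ∈ Finset.Icc k N, b (opA k β φ i) (opC k β φ i) := by
  obtain ⟨P, hP⟩ := exists_sum_mul_eq b hsymm hpos φ (N + 1)
  have h₁ : ∑ q ∈ Finset.range k, b (φ q) (φ q) = ∑ l, ∑ q ∈ Finset.range k, P l q ^ 2 := by
    rw [Finset.sum_comm]
    refine Finset.sum_congr rfl fun q hq ↦ ?_
    have : q < N + 1 := by grind
    simp only [hP q this q this, sq]
  have h₂ : ∑ i ∈ Finset.Icc k N, b (opA k β φ i) (opC k β φ i) =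
      ∑ l, ∑ i ∈ Finset.Icc k N, opA k β (P l) i * opC k β (P l) i := by
    rw [Finset.sum_comm]
    refine Finset.sum_congr rfl fun i hi ↦ ?_
    exact bilin_sum_smul_sum_smul hP _ _ (by grind) (by grind)
  rw [h₁, h₂, hP N N.lt_succ_self N N.lt_succ_self, Finset.mul_sum, Finset.mul_sum,
    ← Finset.sum_add_distrib]
  refine Finset.sum_le_sum fun l _ ↦ ?_
  rw [← sq]
  exact h (P l) N hN

lemma sum_bilin_opB_opC_nonneg {k : ℕ} {β η C : ℝ}
    (h : ∀ (x : ℕ → ℝ) (N : ℕ), k ≤ N → 0 ≤ C * ∑ q ∈ Finset.range k, x q ^ 2 +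
        ∑ i ∈ Finset.Icc k N, (opB k β x i - η * opC k β x i) * opC k β x i)
    (hsymm : ∀ u v, b u v = b v u) (hpos : ∀ u, 0 ≤ b u u) {N : ℕ} (hN : k ≤ N) :
    0 ≤ C * ∑ q ∈ Finset.range k, b (φ q) (φ q) +
      ∑ i ∈ Finset.Icc k N,
        (b (opB k β φ i) (opC k β φ i) - η * b (opC k β φ i) (opC k β φ i)) := by
  obtain ⟨P, hP⟩ := exists_sum_mul_eq b hsymm hpos φ (N + 1)
  have h₁ : ∑ q ∈ Finset.range k, b (φ q) (φ q) = ∑ l, ∑ q ∈ Finset.range k, P l q ^ 2 := by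
    rw [Finset.sum_comm]
    refine Finset.sum_congr rfl fun q hq ↦ ?_
    have : q < N + 1 := by grind
    simp only [hP q this q this, sq]
  have h₂ : ∑ i ∈ Finset.Icc k N,
        (b (opB k β φ i) (opC k β φ i) - η * b (opC k β φ i) (opC k β φ i)) =
      ∑ l, ∑ i ∈ Finset.Icc k N, (opB k β (P l) i - η * opC k β (P l) i) * opC k β (P l) i := by
    rw [Finset.sum_comm]
    refine Finset.sum_congr rfl fun i hi ↦ ?_
    have hB : b (opB k β φ i) (opC k β φ i) = ∑ l, opB k β (P l) i * opC k β (P l) i :=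
      bilin_sum_smul_sum_smul hP _ _ (by grind) (by grind)
    have hC : b (opC k β φ i) (opC k β φ i) = ∑ l, opC k β (P l) i * opC k β (P l) i :=
      bilin_sum_smul_sum_smul hP _ _ (by grind) (by grind)
    rw [hB, hC, Finset.mul_sum, ← Finset.sum_sub_distrib]
    exact Finset.sum_congr rfl fun l _ ↦ by ring
  rw [h₁, h₂, Finset.mul_sum, ← Finset.sum_add_distrib]
  exact Finset.sum_nonneg fun l _ ↦ h (P l) N hN

end Transfer

/-! ### Duality estimate for the source. -/

section Energy

variable {V : Type*} [NormedAddCommGroup V] [InnerProductSpace ℝ V]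
  {L : V →ₗ[ℝ] StrongDual ℝ V}

/-- Young's inequality with weight η, so that half of the dissipation absorbs the energy term. -/
lemma apply_le_of_starNorm_sq_le (hL : ∀ u : V, u ≠ 0 → 0 < L u u) {v : StrongDual ℝ V} {K : ℝ≥0}
    (hv : starNorm L v ^ 2 ≤ (K : ℝ≥0∞)) {η : ℝ} (hη : 0 < η) (u : V) :
    v u ≤ K / (2 * η) + η / 2 * L u u := by
  rcases eq_or_ne u 0 with rfl | hu
  · simp
    positivity
  have hLu := hL u hu
  have hs : 0 < energyNorm L u := Real.sqrt_pos.2 hLu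
  have hsq : energyNorm L u ^ 2 = L u u := Real.sq_sqrt hLu.le
  set r := |v u| / energyNorm L u with hr
  have hr₀ : 0 ≤ r := by positivity
  have hle : ENNReal.ofReal r ≤ starNorm L v :=
    le_iSup₂ (f := fun (u : V) (_ : u ≠ 0) ↦ ENNReal.ofReal (|v u| / energyNorm L u)) u hu
  have hrK : r ^ 2 ≤ K := by
    have := (pow_le_pow_left' hle 2).trans hv
    rw [← ENNReal.ofReal_pow hr₀] at this
    simpa using ENNReal.toReal_mono ENNReal.coe_ne_top this |>.trans_eq' (by
      rw [ENNReal.toReal_ofReal (by positivity)])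
  have hvu : |v u| = r * energyNorm L u := by rw [hr]; field_simp
  have hyoung : r * energyNorm L u ≤ r ^ 2 / (2 * η) + η / 2 * energyNorm L u ^ 2 := by
    have : r ^ 2 / (2 * η) + η / 2 * energyNorm L u ^ 2 - r * energyNorm L u
        = (r - η * energyNorm L u) ^ 2 / (2 * η) := by
      field_simp
      ring
    have : 0 ≤ (r - η * energyNorm L u) ^ 2 / (2 * η) := by positivity
    linarith
  have : r ^ 2 / (2 * η) ≤ K / (2 * η) := by gcongr
  rw [← hsq]
  linarith [le_abs_self (v u)]

end Energy

end BDFStability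

/-! ### The energy estimate. -/

theorem theorem2 (k : ℕ) (β : ℝ)
    (hkβ : ((k = 2 ∨ k = 3) ∧ 1 < β) ∨ (k = 4 ∧ 2 ≤ β)) :
    -- `g` and `C` depend on `k` and `β` only
    ∃ g C : ℝ, 0 < g ∧
      ∀ (V : Type*) [NormedAddCommGroup V] [InnerProductSpace ℝ V] [CompleteSpace V]
        (H : Type*) [NormedAddCommGroup H] [InnerProductSpace ℝ H] [CompleteSpace H]
        -- `V` is continuously and densely embedded in `H`
        (ι : V →L[ℝ] H) (_ : Function.Injective ι) (_ : DenseRange ι)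
        -- `L : V → V'` is linear, self-adjoint and positive definite
        (L : V →ₗ[ℝ] StrongDual ℝ V) (_ : ∀ u v : V, L u v = L v u)
        (_ : ∀ u : V, u ≠ 0 → 0 < L u u)
        (f : ℝ → StrongDual ℝ V) (C_f : ℝ≥0) (T Δt : ℝ) (_ : 0 < Δt) (φ : ℕ → V)
        (n : ℕ) (_ : k ≤ n + 1) (_ : (n + 1 : ℝ) ≤ T / Δt)
        -- the scheme holds, and the source term is bounded at the times sampled, up to step `n`
        (_ : ∀ m : ℕ, k ≤ m + 1 → m ≤ n → BDFStability.SchemeStep k β Δt ι L f φ m)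
        (_ : ∀ m : ℕ, k ≤ m + 1 → m ≤ n →
          BDFStability.starNorm L (f ((m + β) * Δt)) ^ 2 ≤ (C_f : ℝ≥0∞)),
        g * ‖ι (φ (n + 1))‖ ^ 2
            + 1 / 2 * Δt * BDFStability.eta k β *
              ∑ q ∈ Finset.Icc k (n + 1),
                BDFStability.energyNorm L (BDFStability.opC k β φ q) ^ 2
          ≤ C * ∑ q ∈ Finset.range k,
                (‖ι (φ q)‖ ^ 2 + Δt * BDFStability.energyNorm L (φ q) ^ 2)
            + T * C_f / (2 * BDFStability.eta k β) := by
  open BDFStability in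
  obtain ⟨g, C₁, hg, h₁⟩ := exists_sq_le_sum_opA_mul_opC hkβ
  obtain ⟨C₂, h₂⟩ := exists_sum_opB_mul_opC_nonneg hkβ
  have hη := eta_pos hkβ
  have hk : 1 ≤ k := by omega
  -- The maximum works whatever the signs of `C₁` and `C₂`, since both multiply nonnegative sums.
  refine ⟨g, max C₁ C₂, hg, ?_⟩
  intro V _ _ _ H _ _ _ ι _ _ L hsymm hL f C_f T Δt hΔt φ n hn hT hscheme hf
  have hL₀ (u : V) : 0 ≤ L u u := by
    rcases eq_or_ne u 0 with rfl | hu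
    · simp
    · exact (hL u hu).le
  have hnorm (u : V) : energyNorm L u ^ 2 = L u u := Real.sq_sqrt (hL₀ u)
  let bH : V →ₗ[ℝ] V →ₗ[ℝ] ℝ := (innerₗ H).compl₁₂ ι.toLinearMap ι.toLinearMap
  let bL : V →ₗ[ℝ] V →ₗ[ℝ] ℝ := ContinuousLinearMap.coeLM ℝ ∘ₗ L
  have hbH (u : V) : bH u u = ‖ι u‖ ^ 2 := by simp [bH]
  have hA := le_sum_bilin_opA_opC (b := bH) (φ := φ) h₁
    (fun u v ↦ by simp [bH, real_inner_comm]) (fun u ↦ by rw [hbH]; positivity) hn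
  have hB := sum_bilin_opB_opC_nonneg (b := bL) (φ := φ) h₂ hsymm hL₀ hn
  simp only [hbH] at hA
  change 0 ≤ C₂ * ∑ q ∈ Finset.range k, L (φ q) (φ q) + ∑ i ∈ Finset.Icc k (n + 1),
    (L (opB k β φ i) (opC k β φ i) - eta k β * L (opC k β φ i) (opC k β φ i)) at hB
  -- The scheme tested with `opC`, arranged so that the last bracket is the summand of `hB`.
  have hstep (i : ℕ) (hi : i ∈ Finset.Icc k (n + 1)) :
      bH (opA k β φ i) (opC k β φ i) ≤ Δt * (C_f / (2 * eta k β)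
        - eta k β / 2 * L (opC k β φ i) (opC k β φ i)
        - (L (opB k β φ i) (opC k β φ i) - eta k β * L (opC k β φ i) (opC k β φ i))) := by
    rw [Finset.mem_Icc] at hi
    obtain ⟨m, rfl⟩ := Nat.exists_eq_add_of_le' (hk.trans hi.1)
    have hs := DFunLike.congr_fun (hscheme m hi.1 (by omega)) (opC k β φ (m + 1))
    have hle := apply_le_of_starNorm_sq_le hL (hf m hi.1 (by omega)) hη (opC k β φ (m + 1))
    rw [← hs] at hle
    have hle' : 1 / Δt * bH (opA k β φ (m + 1)) (opC k β φ (m + 1))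
        + L (opB k β φ (m + 1)) (opC k β φ (m + 1)) ≤
        C_f / (2 * eta k β) + eta k β / 2 * L (opC k β φ (m + 1)) (opC k β φ (m + 1)) := hle
    rw [one_div, ← le_sub_iff_add_le, inv_mul_le_iff₀ hΔt] at hle'
    exact hle'.trans_eq (by ring)
  have hsum := Finset.sum_le_sum hstep
  rw [← Finset.mul_sum, Finset.sum_sub_distrib, Finset.sum_sub_distrib, ← Finset.mul_sum,
    Finset.sum_const, Nat.card_Icc, nsmul_eq_mul] at hsum
  -- There are n + 2 - k ≤ n + 1 summands because k ≥ 1, and (n + 1)Δt ≤ T.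
  have hcount : Δt * (((n + 1 + 1 - k : ℕ) : ℝ) * (C_f / (2 * eta k β))) ≤
      T * C_f / (2 * eta k β) := by
    have hc : ((n + 1 + 1 - k : ℕ) : ℝ) ≤ n + 1 := by
      exact_mod_cast (by omega : n + 1 + 1 - k ≤ n + 1)
    rw [le_div_iff₀ hΔt] at hT
    have : Δt * ((n + 1 + 1 - k : ℕ) : ℝ) ≤ T := by nlinarith
    rw [← mul_assoc, mul_div_assoc]
    exact mul_le_mul_of_nonneg_right this (by positivity)
  have hX : C₁ * ∑ q ∈ Finset.range k, ‖ι (φ q)‖ ^ 2 ≤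
      max C₁ C₂ * ∑ q ∈ Finset.range k, ‖ι (φ q)‖ ^ 2 :=
    mul_le_mul_of_nonneg_right (le_max_left _ _) (by positivity)
  have hY : C₂ * ∑ q ∈ Finset.range k, L (φ q) (φ q) ≤
      max C₁ C₂ * ∑ q ∈ Finset.range k, L (φ q) (φ q) :=
    mul_le_mul_of_nonneg_right (le_max_right _ _) (Finset.sum_nonneg fun q _ ↦ hL₀ _)
  have hY' := mul_le_mul_of_nonneg_left (hB.trans (add_le_add_left hY _)) hΔt.le
  simp only [hnorm, Finset.sum_add_distrib, ← Finset.mul_sum]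
  linarith
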